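/- Let $(E,\mathcal B)$ be a measurable space and $m$ a nonzero finite positive measure on it. Let $P$ be either (a) a Markovian operator on $L^p(m)$ for some $1\le p<\infty$, i.e. a linear operator on the real space $L^p(m)$ which is positivity preserving ($f\ge 0 \Rightarrow Pf\ge 0$) and satisfies $P1=1$; or (b) a Markov kernel on $(E,\mathcal B)$ such that the measure $m\circ P=\int_E P(x,\cdot)\,m(dx)$ is absolutely continuous with respect to $m$. Write $m(f)=\int_E f\,dm$ and $S_n=\frac1n\sum_{k=0}^{n-1}P^k$ for $n\ge 1$. A set function $\phi:\mathcal B\to[0,\infty)$ is called absolutely continuous with respect to $m$ if $\lim_{m(A)\to 0}\phi(A)=0$. A measure $\nu$ (with $\nu\ll m$ in case (a)) is invariant for $P$ if $\int Pf\,d\nu=\int f\,d\nu$ for all bounded $\mathcal B$-measurable $f:E\to\mathbb R$. The measure $m$ is called almost invariant for $P$ (respectively mean almost invariant for $P$) if there exist $\delta\in[0,1)$, a set function $\phi:\mathcal B\to[0,\infty)$ absolutely continuous with respect to $m$, and $n_0\in\mathbb N$ such that, for all $n>n_0$ and all $A\in\mathcal B$, $$m(P^n1_A)\le \phi(A)+\delta\,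 m(E)\qquad\text{(respectively } m(S_n1_A)\le\phi(A)+\delta\, m(E)\text{)}.$$ Finally, put $$c(P,m)=\lim_{\varepsilon\searrow 0}\ \sup_{A\in\mathcal B,\ m(A)\le\varepsilon}\ \sup_{n\ge 1}\ m(S_n1_A).$$ Then the following assertions are equivalent: (i) there exists a nonzero finite positive measure which is invariant for $P$ and absolutely continuous with respect to $m$; (ii) $m$ is almost invariant for $P$; (iii) $m$ is mean almost invariant for $P$; (iv) $c(P,m)<m(E)$. -/

import Mathlib

open MeasureTheory ProbabilityTheory Filter Topology Set
open scoped ENNReal NNReal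

noncomputable section

namespace AlmostInvariance

variable {E : Type*} [MeasurableSpace E]

/-- The σ-algebra of the measurable space `E`, as a type. -/
abbrev SigmaAlg (E : Type*) [MeasurableSpace E] : Type _ := {A : Set E // MeasurableSet A}

/-- A set function `φ : 𝓑 → [0, ∞)` is absolutely continuous with respect to `m` if
`φ(A) → 0` as `m(A) → 0`. -/
def AbsCont (m : Measure E) (φ : SigmaAlg E → ℝ≥0) : Prop :=
  ∀ ε : ℝ, 0 < ε → ∃ η : ℝ, 0 < η ∧ ∀ A : SigmaAlg E, m.real A < η → (φ A : ℝ) < ε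

/-- For a sequence of set functions `a n : 𝓑 → ℝ`: there are `δ ∈ [0, 1)`, a set function `φ`
absolutely continuous with respect to `m` and an `n₀` with
`a n A ≤ φ(A) + δ m(E)` for all `n > n₀` and all `A ∈ 𝓑`. -/
def EventuallyDominated (m : Measure E) (a : ℕ → SigmaAlg E → ℝ) : Prop :=
  ∃ δ : ℝ, 0 ≤ δ ∧ δ < 1 ∧ ∃ φ : SigmaAlg E → ℝ≥0, AbsCont m φ ∧
    ∃ n₀ : ℕ, ∀ n : ℕ, n₀ < n → ∀ A : SigmaAlg E, a n A ≤ φ A + δ * m.real univ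

/-- `sup_{A ∈ 𝓑, m(A) ≤ ε} sup_{n ≥ 1} a n A`, as an extended nonnegative real. -/
def supOnSmall (m : Measure E) (a : ℕ → SigmaAlg E → ℝ) (ε : ℝ≥0∞) : ℝ≥0∞ :=
  ⨆ (A : SigmaAlg E) (_ : m A ≤ ε) (n : ℕ) (_ : 1 ≤ n), ENNReal.ofReal (a n A)

/-- `lim_{ε ↘ 0} sup_{A ∈ 𝓑, m(A) ≤ ε} sup_{n ≥ 1} a n A`. -/
def concentrationIndex (m : Measure E) (a : ℕ → SigmaAlg E → ℝ) : ℝ≥0∞ :=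
  limUnder (𝓝[>] (0 : ℝ≥0∞)) (supOnSmall m a)

theorem supOnSmall_mono (m : Measure E) (a : ℕ → SigmaAlg E → ℝ) :
    Monotone (supOnSmall m a) := by
  intro ε ε' h
  exact iSup_mono fun A => iSup_mono' fun hA => ⟨hA.trans h, le_rfl⟩

/-- The limit defining the index always exists. -/
theorem tendsto_concentrationIndex (m : Measure E) (a : ℕ → SigmaAlg E → ℝ) :
    Tendsto (supOnSmall m a) (𝓝[>] 0) (𝓝 (concentrationIndex m a)) :=
  tendsto_nhds_limUnder ⟨_, (supOnSmall_mono m a).tendsto_nhdsGT 0⟩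

/-! ### Operators on `L^p(m)` -/

section LpOperator

variable {m : Measure E} [IsFiniteMeasure m] {p : ℝ≥0∞}

/-- A linear operator on `L^p(m)` is Markovian if it is positivity preserving and maps the
constant function `1` to itself. -/
structure IsMarkovian (P : Lp ℝ p m →ₗ[ℝ] Lp ℝ p m) : Prop where
  nonneg : ∀ f : Lp ℝ p m, 0 ≤ f → 0 ≤ P f
  map_one : P (Lp.const p m (1 : ℝ)) = Lp.const p m (1 : ℝ)

/-- The class of the indicator function `1_A` in `L^p(m)`. -/
def indLp (m : Measure E) [IsFiniteMeasure m] (p : ℝ≥0∞) (A : SigmaAlg E) : Lp ℝ p m :=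
  indicatorConstLp p A.2 (measure_ne_top m A) (1 : ℝ)

/-- The Cesàro means `S_n = (1/n) ∑_{k<n} P^k`. -/
def cesaroLp (P : Lp ℝ p m →ₗ[ℝ] Lp ℝ p m) (n : ℕ) : Lp ℝ p m →ₗ[ℝ] Lp ℝ p m :=
  (1 / (n : ℝ)) • ∑ k ∈ Finset.range n, P ^ k

/-- `m(P^n 1_A)`. -/
def powMassLp (P : Lp ℝ p m →ₗ[ℝ] Lp ℝ p m) (n : ℕ) (A : SigmaAlg E) : ℝ :=
  ∫ x, (P ^ n) (indLp m p A) x ∂m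

/-- `m(S_n 1_A)`. -/
def cesaroMassLp (P : Lp ℝ p m →ₗ[ℝ] Lp ℝ p m) (n : ℕ) (A : SigmaAlg E) : ℝ :=
  ∫ x, cesaroLp P n (indLp m p A) x ∂m

/-- `ν` is absolutely continuous with respect to `m` and invariant for the operator `P` on
`L^p(m)`: `∫ P f dν = ∫ f dν` for all bounded measurable `f`. Absolute continuity makes the
left-hand side independent of the representative of `P f`. -/
def IsACInvariantLp (P : Lp ℝ p m →ₗ[ℝ] Lp ℝ p m) (ν : Measure E) : Prop :=
  ν ≪ m ∧ ∀ (f : E → ℝ) (hf : Measurable f) (C : ℝ) (hC : ∀ x, ‖f x‖ ≤ C),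
    ∫ x, P ((MemLp.of_bound hf.aestronglyMeasurable C (ae_of_all m hC)).toLp f) x ∂ν
      = ∫ x, f x ∂ν

/-- `m` is almost invariant for `P`. -/
def AlmostInvariantLp (P : Lp ℝ p m →ₗ[ℝ] Lp ℝ p m) : Prop :=
  EventuallyDominated m (powMassLp P)

/-- `m` is mean almost invariant for `P`. -/
def MeanAlmostInvariantLp (P : Lp ℝ p m →ₗ[ℝ] Lp ℝ p m) : Prop :=
  EventuallyDominated m (cesaroMassLp P)

/-- The index `c(P, m)`. -/
def indexLp (P : Lp ℝ p m →ₗ[ℝ] Lp ℝ p m) : ℝ≥0∞ :=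
  concentrationIndex m (cesaroMassLp P)

end LpOperator

/-! ### Kernels -/

section KernelOperator

/-- `m(P^n 1_A) = ∫ P^n(x, A) m(dx)`. -/
def powMassKer (P : Kernel E E) (m : Measure E) (n : ℕ) (A : SigmaAlg E) : ℝ :=
  ∫ x, ((P ^ n) x).real A ∂m

/-- `m(S_n 1_A)`, where `S_n 1_A (x) = (1/n) ∑_{k<n} P^k(x, A)`. -/
def cesaroMassKer (P : Kernel E E) (m : Measure E) (n : ℕ) (A : SigmaAlg E) : ℝ :=
  ∫ x, (1 / (n : ℝ)) * ∑ k ∈ Finset.range n, ((P ^ k) x).real A ∂m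

/-- `m` is almost invariant for `P`. -/
def AlmostInvariantKer (P : Kernel E E) (m : Measure E) : Prop :=
  EventuallyDominated m (powMassKer P m)

/-- `m` is mean almost invariant for `P`. -/
def MeanAlmostInvariantKer (P : Kernel E E) (m : Measure E) : Prop :=
  EventuallyDominated m (cesaroMassKer P m)

/-- The index `c(P, m)`. -/
def indexKer (P : Kernel E E) (m : Measure E) : ℝ≥0∞ :=
  concentrationIndex m (cesaroMassKer P m)

end KernelOperator

end AlmostInvariance

end

/-! Both cases reduce to a positive, mass-preserving action `T` on measures `ν ≪ m`, given by `T ν A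
= ∫ P 1_A dν`, so that `m(P^n 1_A)` is the mass of `A` under `T^[n] m` (`IsDualMarkov`).

If `ν ≪ m` is invariant and nonzero, then `m.restrict D ≤ c • ν` for some `D` of positive measure,
hence `T^[n] m ≤ c • ν + T^[n] (m.restrict Dᶜ)`, and the last term has mass `m Dᶜ < m univ`.
Averaging gives the mean version. The averages with `n ≤ n₀` are dominated by one measure `≪ m`, so
the mean version forces the index below `m univ`.

The substance is the return to an invariant measure. An ultrafilter limit of the Cesàro averages of
`T^[k] m` is a finitely additive `T`-invariant set function of mass `m univ`. Its countably additive
part `λ` is the largest measure below it. Integrals against `λ` do not exceed the limiting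
integrals, so `T λ` is also below the limit; maximality gives `T λ ≤ λ`, and equality of masses
gives `T λ = λ`. If the index is less than `m univ`, the limit cannot lose all its mass on small
sets, so `λ ≠ 0` (`ultraMass_univ_le_add`). -/

namespace AlmostInvariance

/-! ### Ultrafilter limits of measures and their countably additive part. -/

section UltraLimit

variable {E : Type*} [MeasurableSpace E]

/-- The setwise limit of a sequence of measures along an ultrafilter, a finitely additive set
function. -/
noncomputable def ultraMass (U : Ultrafilter ℕ) (S : ℕ → Measure E) (A : Set E) : ℝ≥0∞ :=
  (U.map fun n => S n A).lim

theorem tendsto_ultraMass (U : Ultrafilter ℕ) (S : ℕ → Measure E) (A : Set E) :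
    Tendsto (fun n => S n A) U (𝓝 (ultraMass U S A)) :=
  (U.map fun n => S n A).le_nhds_lim

theorem ultraMass_empty (U : Ultrafilter ℕ) (S : ℕ → Measure E) : ultraMass U S ∅ = 0 :=
  tendsto_nhds_unique (tendsto_ultraMass U S ∅) (by simp)

theorem ultraMass_inter_add_diff (U : Ultrafilter ℕ) (S : ℕ → Measure E) {s : Set E}
    (hs : MeasurableSet s) (t : Set E) :
    ultraMass U S (t ∩ s) + ultraMass U S (t \ s) = ultraMass U S t := by
  refine tendsto_nhds_unique ((tendsto_ultraMass U S _).add (tendsto_ultraMass U S _)) ?_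
  simpa only [measure_inter_add_sdiff _ hs] using tendsto_ultraMass U S t

/-- The countably additive part of `ultraMass U S`. -/
noncomputable def ultraMeasure (U : Ultrafilter ℕ) (S : ℕ → Measure E) : Measure E :=
  (OuterMeasure.ofFunction (ultraMass U S) (ultraMass_empty U S)).toMeasure fun _ hs =>
    OuterMeasure.ofFunction_caratheodory fun t => (ultraMass_inter_add_diff U S hs t).le

theorem ultraMeasure_apply (U : Ultrafilter ℕ) (S : ℕ → Measure E) {A : Set E}
    (hA : MeasurableSet A) : ultraMeasure U S A =
      OuterMeasure.ofFunction (ultraMass U S) (ultraMass_empty U S) A :=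
  toMeasure_apply _ _ hA

theorem ultraMeasure_le (U : Ultrafilter ℕ) (S : ℕ → Measure E) {A : Set E}
    (hA : MeasurableSet A) : ultraMeasure U S A ≤ ultraMass U S A := by
  rw [ultraMeasure_apply U S hA]
  exact OuterMeasure.ofFunction_le A

/-- One measurable hull serves all the `S n` at once; this lets arbitrary covers be replaced by
measurable ones. -/
theorem exists_measurable_ultraMass_eq (U : Ultrafilter ℕ) (S : ℕ → Measure E) (s : Set E) :
    ∃ t, s ⊆ t ∧ MeasurableSet t ∧ ultraMass U S t = ultraMass U S s := by
  obtain ⟨t, hst, ht, hSt⟩ := exists_measurable_superset_forall_eq S s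
  exact ⟨t, hst, ht, by simp only [ultraMass, hSt]⟩

/-- Maximality: `OuterMeasure.ofFunction` is the largest outer measure below its generating
function, and measurable hulls carry the bound from measurable sets to all sets. -/
theorem le_ultraMeasure (U : Ultrafilter ℕ) (S : ℕ → Measure E) {ν : Measure E}
    (h : ∀ A, MeasurableSet A → ν A ≤ ultraMass U S A) : ν ≤ ultraMeasure U S := by
  refine Measure.le_iff.2 fun A hA => ?_
  rw [ultraMeasure_apply U S hA]
  refine OuterMeasure.le_ofFunction (μ := ν.toOuterMeasure).2 (fun s => ?_) A
  obtain ⟨t, hst, ht, hSt⟩ := exists_measurable_ultraMass_eq U S s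
  exact (measure_mono hst).trans ((h t ht).trans hSt.le)

/-- Fatou-type comparison of integrals with the ultrafilter limit. -/
theorem lintegral_ultraMeasure_le (U : Ultrafilter ℕ) (S : ℕ → Measure E) (f : E → ℝ≥0∞)
    {a : ℝ≥0∞} (ha : Tendsto (fun n => ∫⁻ x, f x ∂S n) U (𝓝 a)) :
    ∫⁻ x, f x ∂ultraMeasure U S ≤ a := by
  rw [lintegral_eq_nnreal]
  refine iSup₂_le fun g hg => ?_
  rw [SimpleFunc.map_lintegral]
  -- For a simple function below `f` the integral is a finite sum, so it passes to the limit; there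
  -- `ultraMeasure ≤ ultraMass` applies level by level.
  have h1 : Tendsto (fun n => (g.map ((↑) : ℝ≥0 → ℝ≥0∞)).lintegral (S n)) U
      (𝓝 (∑ y ∈ g.range, (y : ℝ≥0∞) * ultraMass U S (g ⁻¹' {y}))) := by
    simp only [SimpleFunc.map_lintegral]
    exact tendsto_finsetSum _ fun y _ =>
      ENNReal.Tendsto.const_mul (tendsto_ultraMass U S _) (Or.inr ENNReal.coe_ne_top)
  refine (Finset.sum_le_sum fun y _ => ?_).trans (le_of_tendsto_of_tendsto' h1 ha fun n => ?_)
  · exact mul_le_mul_right (ultraMeasure_le U S (g.measurableSet_preimage _)) _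
  · rw [← SimpleFunc.lintegral_eq_lintegral]
    exact lintegral_mono fun x => hg x

/-- If the limit set function has mass at most `c` on small sets, its countably additive part
carries all the mass up to `c`. -/
theorem ultraMass_univ_le_add (U : Ultrafilter ℕ) (S : ℕ → Measure E) (m : Measure E)
    [IsFiniteMeasure m] {ε c : ℝ≥0∞} (hε : 0 < ε)
    (h : ∀ A, MeasurableSet A → m A ≤ ε → ultraMass U S A ≤ c) :
    ultraMass U S univ ≤ ultraMeasure U S univ + c := by
  rw [ultraMeasure_apply U S MeasurableSet.univ, OuterMeasure.ofFunction_apply]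
  simp_rw [ENNReal.iInf_add]
  refine le_iInf₂ fun t ht => ?_
  choose t' htt' ht' hSt using fun i => exists_measurable_ultraMass_eq U S (t i)
  have hmass : ∀ N, ultraMass U S univ ≤ ∑ i ∈ Finset.range N, ultraMass U S (t i)
      + ultraMass U S (⋃ i ∈ Finset.range N, t' i)ᶜ := by
    intro N
    have hT : Tendsto (fun n => ∑ i ∈ Finset.range N, S n (t' i)
        + S n (⋃ i ∈ Finset.range N, t' i)ᶜ) U (𝓝 (∑ i ∈ Finset.range N, ultraMass U S (t i)
      + ultraMass U S (⋃ i ∈ Finset.range N, t' i)ᶜ)) := by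
      refine (tendsto_finsetSum _ fun i _ => ?_).add (tendsto_ultraMass U S _)
      rw [← hSt i]
      exact tendsto_ultraMass U S _
    refine le_of_tendsto_of_tendsto' (tendsto_ultraMass U S univ) hT fun n => ?_
    rw [← union_compl_self (⋃ i ∈ Finset.range N, t' i)]
    exact (measure_union_le _ _).trans (by gcongr; exact measure_biUnion_finset_le _ _)
  -- The `t i` cover the space, so what the first `N` hulls miss decreases to the empty set. Once
  -- its `m`-measure is below `ε`, its limit mass is at most `c`.
  have hlim : Tendsto (fun N => m (⋃ i ∈ Finset.range N, t' i)ᶜ) atTop (𝓝 0) := by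
    have h0 : ⋂ N, (⋃ i ∈ Finset.range N, t' i)ᶜ = ∅ := by
      refine eq_empty_of_forall_notMem fun x hx => ?_
      obtain ⟨i, hi⟩ := mem_iUnion.1 (ht (mem_univ x))
      exact mem_iInter.1 hx (i + 1) (mem_biUnion (by simp) (htt' i hi))
    rw [← measure_empty (μ := m), ← h0]
    refine tendsto_measure_iInter_atTop
      (fun N => (Finset.measurableSet_biUnion _ fun i _ => ht' i).compl.nullMeasurableSet)
      (fun a b hab => ?_) ⟨0, measure_ne_top _ _⟩
    exact compl_subset_compl.2 (biUnion_mono (fun i hi =>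
      Finset.range_mono hab hi) fun _ _ => Subset.rfl)
  obtain ⟨N, hN⟩ := (hlim.eventually_lt_const hε).exists
  refine (hmass N).trans (add_le_add (ENNReal.sum_le_tsum _) (h _ ?_ hN.le))
  exact (Finset.measurableSet_biUnion _ fun i _ => ht' i).compl

end UltraLimit

/-! ### The equivalence for a dual Markov action on measures. -/

section Abstract

variable {E : Type*} [MeasurableSpace E] {m : Measure E} {Q : Set E → E → ℝ≥0∞}
  {T : Measure E → Measure E}

/-- The integral of the integrable density `ν.rnDeriv m` is uniformly small on small sets. -/
theorem exists_pos_measure_lt_of_ac {ν : Measure E} [IsFiniteMeasure m] [IsFiniteMeasure ν]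
    (h : ν ≪ m) {ε : ℝ≥0∞} (hε : ε ≠ 0) :
    ∃ η > 0, ∀ A : Set E, m A < η → ν A < ε := by
  obtain ⟨η, hη, H⟩ := exists_pos_setLIntegral_lt_of_measure_lt
    (f := ν.rnDeriv m) (μ := m) (Measure.lintegral_rnDeriv_lt_top ν m).ne hε
  exact ⟨η, hη, fun A hA => by simpa [Measure.setLIntegral_rnDeriv h] using H A hA⟩

theorem absCont_of_ac {ν : Measure E} [IsFiniteMeasure m] [IsFiniteMeasure ν] (h : ν ≪ m) :
    AbsCont m fun A => (ν A).toNNReal := by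
  intro ε hε
  obtain ⟨η, hη, H⟩ := exists_pos_measure_lt_of_ac h (ENNReal.ofReal_pos.2 hε).ne'
  -- The minimum with `1` guards against `η = ∞`, whose `toReal` is `0`.
  refine ⟨(min η 1).toReal, ENNReal.toReal_pos (by positivity) (by simp), fun A hA => ?_⟩
  have hA' : m A < min η 1 :=
    (ENNReal.toReal_lt_toReal (measure_ne_top _ _) (by simp)).1 hA
  have := H A (hA'.trans_le (min_le_left _ _))
  exact (ENNReal.lt_ofReal_iff_toReal_lt (measure_ne_top _ _)).1 this

/-- `T` is the action on measures absolutely continuous with respect to `m` of the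
Markov operator determined, up to `m`-null sets, by the functions `Q A` (the image of `1_A`). -/
structure IsDualMarkov (m : Measure E) (Q : Set E → E → ℝ≥0∞) (T : Measure E → Measure E) :
    Prop where
  apply : ∀ ν, ν ≪ m → ∀ A, MeasurableSet A → T ν A = ∫⁻ x, Q A x ∂ν
  meas : ∀ A, MeasurableSet A → Measurable (Q A)
  map_univ : ∀ ν, ν ≪ m → T ν univ = ν univ
  ac : ∀ ν, ν ≪ m → T ν ≪ m

namespace IsDualMarkov

theorem map_add (h : IsDualMarkov m Q T) {ν₁ ν₂ : Measure E} (h₁ : ν₁ ≪ m) (h₂ : ν₂ ≪ m) :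
    T (ν₁ + ν₂) = T ν₁ + T ν₂ := by
  ext A hA
  rw [h.apply _ (h₁.add_left h₂) A hA, lintegral_add_measure, Measure.add_apply,
    h.apply _ h₁ A hA, h.apply _ h₂ A hA]

theorem map_smul (h : IsDualMarkov m Q T) {ν : Measure E} (hν : ν ≪ m) (c : ℝ≥0∞) :
    T (c • ν) = c • T ν := by
  ext A hA
  rw [h.apply _ (hν.smul_left c) A hA, lintegral_smul_measure, Measure.smul_apply,
    h.apply _ hν A hA]

theorem mono (h : IsDualMarkov m Q T) {ν₁ ν₂ : Measure E} (h₂ : ν₂ ≪ m) (hle : ν₁ ≤ ν₂) :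
    T ν₁ ≤ T ν₂ := by
  refine Measure.le_iff.2 fun A hA => ?_
  rw [h.apply _ (hle.absolutelyContinuous.trans h₂) A hA, h.apply _ h₂ A hA]
  exact lintegral_mono' hle le_rfl

theorem map_sum (h : IsDualMarkov m Q T) {ν : ℕ → Measure E} (hν : ∀ n, ν n ≪ m) (n : ℕ) :
    (∑ k ∈ Finset.range n, ν k) ≪ m ∧
      T (∑ k ∈ Finset.range n, ν k) = ∑ k ∈ Finset.range n, T (ν k) := by
  induction n with
  | zero =>
    refine ⟨by simp [Measure.AbsolutelyContinuous.zero], ?_⟩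
    have := h.map_univ 0 (Measure.AbsolutelyContinuous.zero m)
    simpa using this
  | succ n ih =>
    rw [Finset.sum_range_succ, Finset.sum_range_succ]
    exact ⟨ih.1.add_left (hν n), by rw [h.map_add ih.1 (hν n), ih.2]⟩

theorem iterate_ac (h : IsDualMarkov m Q T) {ν : Measure E} (hν : ν ≪ m) (n : ℕ) :
    T^[n] ν ≪ m := by
  induction n with
  | zero => exact hν
  | succ n ih => rw [Function.iterate_succ_apply']; exact h.ac _ ih

theorem iterate_univ (h : IsDualMarkov m Q T) {ν : Measure E} (hν : ν ≪ m) (n : ℕ) :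
    T^[n] ν univ = ν univ := by
  induction n with
  | zero => rfl
  | succ n ih => rw [Function.iterate_succ_apply', h.map_univ _ (h.iterate_ac hν n), ih]

theorem iterate_add (h : IsDualMarkov m Q T) {ν₁ ν₂ : Measure E} (h₁ : ν₁ ≪ m) (h₂ : ν₂ ≪ m)
    (n : ℕ) : T^[n] (ν₁ + ν₂) = T^[n] ν₁ + T^[n] ν₂ := by
  induction n with
  | zero => rfl
  | succ n ih =>
    simp only [Function.iterate_succ_apply', ih, h.map_add (h.iterate_ac h₁ n) (h.iterate_ac h₂ n)]

theorem iterate_mono (h : IsDualMarkov m Q T) {ν₁ ν₂ : Measure E} (h₂ : ν₂ ≪ m) (hle : ν₁ ≤ ν₂)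
    (n : ℕ) : T^[n] ν₁ ≤ T^[n] ν₂ := by
  induction n with
  | zero => exact hle
  | succ n ih =>
    simp only [Function.iterate_succ_apply']
    exact h.mono (h.iterate_ac h₂ n) ih

theorem isFiniteMeasure_iterate (h : IsDualMarkov m Q T) [IsFiniteMeasure m] (n : ℕ) :
    IsFiniteMeasure (T^[n] m) :=
  ⟨by rw [h.iterate_univ Measure.AbsolutelyContinuous.rfl]; exact measure_lt_top m univ⟩

theorem iterate_real_le (h : IsDualMarkov m Q T) [IsFiniteMeasure m] (n : ℕ) (A : Set E) :
    (T^[n] m).real A ≤ m.real univ := by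
  refine ENNReal.toReal_mono (measure_ne_top m univ) ?_
  rw [← h.iterate_univ Measure.AbsolutelyContinuous.rfl n]
  exact measure_mono (subset_univ _)

end IsDualMarkov

/-- A nonzero absolutely continuous measure dominates a multiple of `m` on a set of positive
measure. -/
theorem exists_smul_restrict_le {ν : Measure E} [IsFiniteMeasure m] [IsFiniteMeasure ν]
    (hν : ν ≪ m) (h0 : ν ≠ 0) :
    ∃ c : ℝ≥0∞, c ≠ ∞ ∧ ∃ D, MeasurableSet D ∧ m D ≠ 0 ∧ m.restrict D ≤ c • ν := by
  -- If every such superlevel set were null, the density would vanish almost everywhere.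
  have hex : ∃ n : ℕ, m {x | ((n : ℝ≥0∞) + 1)⁻¹ ≤ ν.rnDeriv m x} ≠ 0 := by
    by_contra! hcon
    have hae : ∀ᵐ x ∂m, ∀ n : ℕ, ν.rnDeriv m x < ((n : ℝ≥0∞) + 1)⁻¹ :=
      ae_all_iff.2 fun n => by simpa [ae_iff] using hcon n
    apply h0
    rw [← Measure.withDensity_rnDeriv_eq ν m hν]
    refine withDensity_eq_zero_iff (Measure.measurable_rnDeriv ν m).aemeasurable |>.2 ?_
    filter_upwards [hae] with x hx
    by_contra hne
    obtain ⟨n, hn⟩ := ENNReal.exists_inv_nat_lt hne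
    refine (hx n).not_ge (le_trans ?_ hn.le)
    exact ENNReal.inv_le_inv.2 le_self_add
  obtain ⟨n, hn⟩ := hex
  have hD : MeasurableSet {x | ((n : ℝ≥0∞) + 1)⁻¹ ≤ ν.rnDeriv m x} :=
    measurableSet_le measurable_const (Measure.measurable_rnDeriv ν m)
  refine ⟨n + 1, by simp, _, hD, hn, Measure.le_iff.2 fun A hA => ?_⟩
  rw [Measure.restrict_apply hA, Measure.smul_apply, smul_eq_mul, ← ENNReal.inv_mul_le_iff
    (by simp) (by simp)]
  calc _ = ∫⁻ x in A ∩ {x | ((n : ℝ≥0∞) + 1)⁻¹ ≤ ν.rnDeriv m x}, ((n : ℝ≥0∞) + 1)⁻¹ ∂m := by simp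
    _ ≤ ∫⁻ x in A ∩ {x | ((n : ℝ≥0∞) + 1)⁻¹ ≤ ν.rnDeriv m x}, ν.rnDeriv m x ∂m :=
      setLIntegral_mono' (hA.inter hD) fun x hx => hx.2
    _ ≤ ν (A ∩ {x | ((n : ℝ≥0∞) + 1)⁻¹ ≤ ν.rnDeriv m x}) := Measure.setLIntegral_rnDeriv_le _
    _ ≤ ν A := measure_mono inter_subset_left

/-- The masses `m(P^n 1_A)`. -/
noncomputable def dualMass (m : Measure E) (T : Measure E → Measure E) (n : ℕ)
    (A : SigmaAlg E) : ℝ :=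
  (T^[n] m).real A

/-- The masses `m(S_n 1_A)`. -/
noncomputable def dualCesaroMass (m : Measure E) (T : Measure E → Measure E) (n : ℕ)
    (A : SigmaAlg E) : ℝ :=
  (1 / (n : ℝ)) * ∑ k ∈ Finset.range n, (T^[k] m).real A

namespace IsDualMarkov

theorem almostInvariant_of_invariant [IsFiniteMeasure m] (h : IsDualMarkov m Q T)
    {ν : Measure E} [IsFiniteMeasure ν] (h0 : ν ≠ 0) (hν : ν ≪ m) (hT : T ν = ν) :
    EventuallyDominated m (dualMass m T) := by
  obtain ⟨c, hc, D, hD, hmD, hle⟩ := exists_smul_restrict_le hν h0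
  have hac : c • ν ≪ m := hν.smul_left c
  have : IsFiniteMeasure (c • ν) := ν.smul_finite hc
  have hinv (n : ℕ) : T^[n] (c • ν) = c • ν :=
    Function.iterate_fixed (by rw [h.map_smul hν, hT]) n
  have hm0 : m univ ≠ 0 := fun h' => hmD (measure_mono_null (subset_univ D) h')
  have hmpos : 0 < m.real univ := ENNReal.toReal_pos hm0 (measure_ne_top _ _)
  have hDpos : 0 < m.real D := ENNReal.toReal_pos hmD (measure_ne_top _ _)
  have hsum : m.real D + m.real Dᶜ = m.real univ := measureReal_add_measureReal_compl hD
  -- The part of `m` on `D` stays under the fixed measure `c • ν`, which serves as `φ`. The part on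
  -- `Dᶜ` is bounded only by its total mass, which fixes `δ`.
  refine ⟨m.real Dᶜ / m.real univ, by positivity, (div_lt_one hmpos).2 (by linarith),
    _, absCont_of_ac hac, 0, fun n _ A => ?_⟩
  rw [div_mul_cancel₀ _ hmpos.ne']
  have hA : T^[n] m A ≤ (c • ν) A + m Dᶜ := by
    have hr (s : Set E) : m.restrict s ≪ m := Measure.absolutelyContinuous_restrict
    conv_lhs => rw [← Measure.restrict_add_restrict_compl (μ := m) hD]
    rw [h.iterate_add (hr _) (hr _), Measure.add_apply]
    refine add_le_add ?_ ?_
    · exact (h.iterate_mono hac hle n A).trans (by rw [hinv])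
    · refine (measure_mono (subset_univ _)).trans ?_
      rw [h.iterate_univ (hr _)]
      simp
  have := ENNReal.toReal_mono (by finiteness) hA
  rwa [ENNReal.toReal_add (by finiteness) (by finiteness)] at this

theorem meanAlmostInvariant [IsFiniteMeasure m] (h : IsDualMarkov m Q T)
    (ha : EventuallyDominated m (dualMass m T)) :
    EventuallyDominated m (dualCesaroMass m T) := by
  obtain ⟨δ, hδ0, hδ1, φ, hφ, n₀, H⟩ := ha
  -- The terms `k ≤ n₀` are bounded only by `m univ`. Beyond `n₁` they contribute at most `(1 - δ) /
  -- 2` of it to the average, and `δ + (1 - δ) / 2 = (1 + δ) / 2`.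
  obtain ⟨n₁, hn₁⟩ := exists_nat_gt (2 * ((n₀ : ℝ) + 1) / (1 - δ))
  refine ⟨(1 + δ) / 2, by linarith, by linarith, φ, hφ, n₁, fun n hn A => ?_⟩
  have hM : 0 ≤ m.real univ := measureReal_nonneg
  have hδ : 0 < 1 - δ := by linarith
  have hn' : 2 * ((n₀ : ℝ) + 1) ≤ n * (1 - δ) := by
    rw [div_lt_iff₀ hδ] at hn₁
    have : (n₁ : ℝ) ≤ n := by exact_mod_cast hn.le
    nlinarith
  have hnpos : (0 : ℝ) < n := by exact_mod_cast (Nat.zero_le _).trans_lt hn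
  have hterm : ∀ k ∈ Finset.range n, (T^[k] m).real A ≤
      (if k < n₀ + 1 then m.real univ else 0) + (φ A + δ * m.real univ) := by
    intro k _
    split_ifs with hk
    · have := h.iterate_real_le k A
      have : 0 ≤ δ * m.real univ := by positivity
      have : (0 : ℝ) ≤ φ A := (φ A).2
      linarith
    · rw [zero_add]
      exact H k (by omega) A
  have hcount : ∑ k ∈ Finset.range n, (if k < n₀ + 1 then m.real univ else 0)
      ≤ (n₀ + 1) * m.real univ := by
    rw [← Finset.sum_filter, Finset.sum_const, nsmul_eq_mul]
    refine mul_le_mul_of_nonneg_right ?_ hM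
    have : (Finset.range n).filter (· < n₀ + 1) ⊆ Finset.range (n₀ + 1) := fun k hk => by
      simpa using (Finset.mem_filter.1 hk).2
    exact_mod_cast (Finset.card_le_card this).trans (by simp)
  have hsum := Finset.sum_le_sum hterm
  rw [Finset.sum_add_distrib, Finset.sum_const, Finset.card_range, nsmul_eq_mul] at hsum
  rw [dualCesaroMass, one_div, inv_mul_le_iff₀ hnpos]
  nlinarith [mul_le_mul_of_nonneg_right hn' hM]

theorem index_lt [IsFiniteMeasure m] (hm : m ≠ 0) (h : IsDualMarkov m Q T)
    (ha : EventuallyDominated m (dualCesaroMass m T)) :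
    concentrationIndex m (dualCesaroMass m T) < m univ := by
  obtain ⟨δ, hδ0, hδ1, φ, hφ, n₀, H⟩ := ha
  have hmpos : 0 < m.real univ :=
    ENNReal.toReal_pos (by simpa using hm) (measure_ne_top _ _)
  -- Half the gap between `δ * m.real univ` and `m.real univ`, so that `g + δ * m.real univ` is
  -- still below `m.real univ`.
  set g := (1 - δ) * m.real univ / 2 with hg
  have hgpos : 0 < g := by have : 0 < 1 - δ := by linarith
                           positivity
  obtain ⟨η, hη, Hη⟩ := hφ g hgpos
  have := h.isFiniteMeasure_iterate
  -- This single sum controls all averages with `1 ≤ n ≤ n₀`, because `1 / n ≤ 1`.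
  have hac := (h.map_sum (h.iterate_ac Measure.AbsolutelyContinuous.rfl) n₀).1
  obtain ⟨η', hη', Hη'⟩ := exists_pos_measure_lt_of_ac hac (ENNReal.ofReal_pos.2 hgpos).ne'
  have hpos : 0 < min (ENNReal.ofReal η) η' := lt_min (ENNReal.ofReal_pos.2 hη) hη'
  obtain ⟨ε, hε, hε'⟩ := exists_between hpos
  have hsup : supOnSmall m (dualCesaroMass m T) ε ≤ ENNReal.ofReal (g + δ * m.real univ) := by
    refine iSup₂_le fun A hA => iSup₂_le fun n hn => ENNReal.ofReal_le_ofReal ?_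
    have hAε := hA.trans_lt hε'
    rcases lt_or_ge n₀ n with hlt | hle
    · have h1 := H n hlt A
      have h2 := Hη A ((ENNReal.lt_ofReal_iff_toReal_lt (measure_ne_top _ _)).1
        (hAε.trans_le (min_le_left _ _)))
      linarith
    · have h1 := (ENNReal.lt_ofReal_iff_toReal_lt (measure_ne_top _ _)).1
        (Hη' A (hAε.trans_le (min_le_right _ _)))
      rw [Measure.finsetSum_apply, ENNReal.toReal_sum (fun _ _ => measure_ne_top _ _)] at h1
      have hn1 : (1 : ℝ) ≤ n := by exact_mod_cast hn
      have h2 : ∑ k ∈ Finset.range n, (T^[k] m).real A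
          ≤ ∑ k ∈ Finset.range n₀, (T^[k] m).real A :=
        Finset.sum_le_sum_of_subset_of_nonneg (Finset.range_mono hle)
          fun _ _ _ => measureReal_nonneg
      have h3 : dualCesaroMass m T n A ≤ ∑ k ∈ Finset.range n, (T^[k] m).real A := by
        refine mul_le_of_le_one_left (Finset.sum_nonneg fun _ _ => measureReal_nonneg) ?_
        rw [div_le_one (by linarith)]
        exact hn1
      have : 0 ≤ δ * m.real univ := by positivity
      have h4 : ∑ k ∈ Finset.range n₀, (T^[k] m).real A < g := h1
      linarith
  have hle : concentrationIndex m (dualCesaroMass m T) ≤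
      supOnSmall m (dualCesaroMass m T) ε := by
    refine le_of_tendsto (tendsto_concentrationIndex m _) ?_
    filter_upwards [Ioo_mem_nhdsGT hε] with ε' h'
    exact supOnSmall_mono m _ h'.2.le
  refine (hle.trans hsup).trans_lt ?_
  rw [ENNReal.ofReal_lt_iff_lt_toReal (by positivity) (measure_ne_top _ _)]
  change _ < m.real univ
  rw [hg]
  nlinarith

/-- The Cesàro averages of the iterates of `m`. -/
noncomputable def cesaroMeasure (m : Measure E) (T : Measure E → Measure E) (n : ℕ) :
    Measure E :=
  (n : ℝ≥0∞)⁻¹ • ∑ k ∈ Finset.range n, T^[k] m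

theorem cesaroMeasure_ac (h : IsDualMarkov m Q T) (n : ℕ) : cesaroMeasure m T n ≪ m :=
  (h.map_sum (h.iterate_ac Measure.AbsolutelyContinuous.rfl) n).1.smul_left _

theorem cesaroMeasure_apply_eq [IsFiniteMeasure m] (h : IsDualMarkov m Q T) {n : ℕ} (hn : n ≠ 0)
    (A : SigmaAlg E) : cesaroMeasure m T n A = ENNReal.ofReal (dualCesaroMass m T n A) := by
  have := h.isFiniteMeasure_iterate
  have hn' : (0 : ℝ) < n := by positivity
  rw [cesaroMeasure, dualCesaroMass, Measure.smul_apply, Measure.finsetSum_apply, smul_eq_mul,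
    ENNReal.ofReal_mul (by positivity), one_div, ENNReal.ofReal_inv_of_pos hn',
    ENNReal.ofReal_natCast, ENNReal.ofReal_sum_of_nonneg fun _ _ => measureReal_nonneg]
  simp

/-- Telescoping: applying `T` shifts the sum by one index. The boundary terms are added to opposite
sides to avoid subtracting measures. -/
theorem map_cesaroMeasure (h : IsDualMarkov m Q T) (n : ℕ) :
    T (cesaroMeasure m T n) + (n : ℝ≥0∞)⁻¹ • m =
      cesaroMeasure m T n + (n : ℝ≥0∞)⁻¹ • T^[n] m := by
  have hs := h.map_sum (h.iterate_ac Measure.AbsolutelyContinuous.rfl) n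
  simp only [cesaroMeasure]
  rw [h.map_smul hs.1, hs.2, ← smul_add, ← smul_add, ← Finset.sum_range_succ,
    Finset.sum_range_succ']
  simp [Function.iterate_succ_apply']

theorem exists_invariant [IsFiniteMeasure m] (h : IsDualMarkov m Q T)
    (hc : concentrationIndex m (dualCesaroMass m T) < m univ) :
    ∃ ν : Measure E, IsFiniteMeasure ν ∧ ν ≠ 0 ∧ ν ≪ m ∧ T ν = ν := by
  obtain ⟨ε, hε, hεpos⟩ := (((tendsto_concentrationIndex m _).eventually_lt_const hc).and
    self_mem_nhdsWithin).exists
  set U : Ultrafilter ℕ := hyperfilter ℕ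
  have hU : (U : Filter ℕ) ≤ atTop := Nat.hyperfilter_le_atTop
  set S := cesaroMeasure m T
  have hpos : ∀ᶠ n in (U : Filter ℕ), n ≠ 0 := hU (eventually_ne_atTop 0)
  have hsmall : ∀ A, MeasurableSet A → m A ≤ ε →
      ultraMass U S A ≤ supOnSmall m (dualCesaroMass m T) ε := by
    intro A hA hmA
    refine le_of_tendsto (tendsto_ultraMass U S A) ?_
    filter_upwards [hpos] with n hn
    rw [h.cesaroMeasure_apply_eq hn ⟨A, hA⟩]
    exact le_iSup₂_of_le ⟨A, hA⟩ hmA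
      (le_iSup₂_of_le (f := fun n _ => ENNReal.ofReal (dualCesaroMass m T n ⟨A, hA⟩))
        n (Nat.one_le_iff_ne_zero.2 hn) le_rfl)
  have huniv : ultraMass U S univ = m univ := by
    refine tendsto_nhds_unique (tendsto_ultraMass U S univ)
      (tendsto_const_nhds.congr' ?_)
    filter_upwards [hpos] with n hn
    have : (n : ℝ≥0∞) ≠ 0 := by exact_mod_cast hn
    simp only [S, cesaroMeasure, Measure.smul_apply, Measure.finsetSum_apply,
      h.iterate_univ Measure.AbsolutelyContinuous.rfl, Finset.sum_const, Finset.card_range,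
      nsmul_eq_mul, smul_eq_mul, ← mul_assoc]
    rw [ENNReal.inv_mul_cancel this (by simp), one_mul]
  have hfin : IsFiniteMeasure (ultraMeasure U S) :=
    ⟨(ultraMeasure_le U S MeasurableSet.univ).trans_lt (huniv ▸ measure_lt_top m univ)⟩
  have hac : ultraMeasure U S ≪ m := by
    refine Measure.AbsolutelyContinuous.mk fun A hA hmA => ?_
    refine le_antisymm ((ultraMeasure_le U S hA).trans ?_) zero_le
    refine le_of_tendsto (tendsto_ultraMass U S A) (Eventually.of_forall fun n => ?_)
    exact (h.cesaroMeasure_ac n hmA).le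
  -- By maximality it suffices to bound `T (ultraMeasure U S)` by the limit set function. The
  -- Fatou-type comparison gives the bound by the limit of `T (S n) A`, which equals that of `S n A`
  -- since the boundary terms are `O(1/n)`.
  have hle : T (ultraMeasure U S) ≤ ultraMeasure U S := by
    refine le_ultraMeasure U S fun A hA => ?_
    rw [h.apply _ hac A hA]
    refine lintegral_ultraMeasure_le U S _ ?_
    have hTS (n : ℕ) : ∫⁻ x, Q A x ∂S n = T (S n) A :=
      (h.apply _ (h.cesaroMeasure_ac n) A hA).symm
    simp only [hTS]
    have hz (c : ℕ → ℝ≥0∞) (hcm : ∀ n, c n ≤ m univ) :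
        Tendsto (fun n : ℕ => (n : ℝ≥0∞)⁻¹ * c n) U (𝓝 0) := by
      have h0 : Tendsto (fun n : ℕ => (n : ℝ≥0∞)⁻¹ * m univ) U (𝓝 (0 * m univ)) :=
        ENNReal.Tendsto.mul_const (ENNReal.tendsto_inv_nat_nhds_zero.mono_left hU)
          (Or.inr (measure_ne_top _ _))
      rw [zero_mul] at h0
      exact tendsto_of_tendsto_of_tendsto_of_le_of_le tendsto_const_nhds h0
        (fun _ => zero_le) fun n => mul_le_mul_right (hcm n) _
    have h1 := (tendsto_ultraMass U (fun n => T (S n)) A).add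
      (hz (fun _ => m A) fun _ => measure_mono (subset_univ _))
    have h2 := (tendsto_ultraMass U S A).add (hz (fun n => T^[n] m A) fun n =>
      (measure_mono (subset_univ _)).trans
        (h.iterate_univ Measure.AbsolutelyContinuous.rfl n).le)
    have h3 (n : ℕ) : T (S n) A + (n : ℝ≥0∞)⁻¹ * m A = S n A + (n : ℝ≥0∞)⁻¹ * T^[n] m A := by
      simpa using congrArg (fun μ : Measure E => μ A) (h.map_cesaroMeasure n)
    simp only [h3, add_zero] at h1 h2
    rw [← tendsto_nhds_unique h1 h2]
    exact tendsto_ultraMass U (fun n => T (S n)) A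
  refine ⟨ultraMeasure U S, hfin, ?_, hac, ?_⟩
  -- A zero countably additive part would force `m univ` below the supremum over sets of measure at
  -- most `ε`, contrary to the choice of `ε`.
  · intro h0
    have := ultraMass_univ_le_add U S m hεpos hsmall
    rw [huniv, h0] at this
    exact (hε.trans_le this).ne (by simp)
  · have : IsFiniteMeasure (T (ultraMeasure U S)) :=
      ⟨by rw [h.map_univ _ hac]; exact measure_lt_top _ _⟩
    exact Measure.eq_of_le_of_measure_univ_eq hle (h.map_univ _ hac)

theorem tfae [IsFiniteMeasure m] (hm : m ≠ 0) (h : IsDualMarkov m Q T) :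
    List.TFAE [
      ∃ ν : Measure E, IsFiniteMeasure ν ∧ ν ≠ 0 ∧ ν ≪ m ∧ T ν = ν,
      EventuallyDominated m (dualMass m T),
      EventuallyDominated m (dualCesaroMass m T),
      concentrationIndex m (dualCesaroMass m T) < m univ] := by
  tfae_have 1 → 2 := fun ⟨_, _, h0, hν, hT⟩ => h.almostInvariant_of_invariant h0 hν hT
  tfae_have 2 → 3 := h.meanAlmostInvariant
  tfae_have 3 → 4 := h.index_lt hm
  tfae_have 4 → 1 := h.exists_invariant
  tfae_finish

end IsDualMarkov

end Abstract

/-! ### Markov kernels. -/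

section KernelCase

variable {E : Type*} [MeasurableSpace E] {m : Measure E}

/-- Absolute continuity passes from `m` to every `ν ≪ m`: if `m A = 0`, then `P x A = 0` for
`m`-almost every `x`, hence for `ν`-almost every `x`. -/
theorem isDualMarkov_bind (P : Kernel E E) [IsMarkovKernel P] (hP : m.bind P ≪ m) :
    IsDualMarkov m (fun A x => P x A) (fun ν => ν.bind P) where
  apply ν _ A hA := Measure.bind_apply hA P.aemeasurable
  meas A hA := P.measurable_coe hA
  map_univ ν _ := by
    rw [Measure.bind_apply MeasurableSet.univ P.aemeasurable]
    simp
  ac ν hν := by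
    refine Measure.AbsolutelyContinuous.mk fun A hA hmA => ?_
    have h0 := hP hmA
    rw [Measure.bind_apply hA P.aemeasurable, lintegral_eq_zero_iff (P.measurable_coe hA)] at h0
    rw [Measure.bind_apply hA P.aemeasurable, lintegral_eq_zero_iff (P.measurable_coe hA)]
    exact hν.ae_le h0

theorem isMarkovKernel_pow (P : Kernel E E) [IsMarkovKernel P] (n : ℕ) :
    IsMarkovKernel (P ^ n) := by
  induction n with
  | zero => exact inferInstanceAs (IsMarkovKernel (Kernel.id : Kernel E E))
  | succ n ih => exact inferInstanceAs (IsMarkovKernel ((P ^ n) ∘ₖ P))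

theorem iterate_bind (P : Kernel E E) (n : ℕ) :
    (fun ν : Measure E => ν.bind P)^[n] m = m.bind (P ^ n : Kernel E E) := by
  induction n with
  | zero => exact Measure.bind_dirac.symm
  | succ n ih =>
    rw [Function.iterate_succ_apply', ih, pow_succ', Measure.comp_assoc]
    rfl

theorem integral_real_eq (P : Kernel E E) [IsMarkovKernel P] (n : ℕ)
    {A : Set E} (hA : MeasurableSet A) :
    ∫ x, ((P ^ n) x).real A ∂m = ((fun ν : Measure E => ν.bind P)^[n] m).real A := by
  have := isMarkovKernel_pow P n
  rw [iterate_bind, Measure.real, Measure.bind_apply hA (P ^ n : Kernel E E).aemeasurable]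
  exact integral_toReal ((P ^ n : Kernel E E).measurable_coe hA).aemeasurable
    (ae_of_all _ fun x => measure_lt_top _ _)

theorem integrable_pow_real [IsFiniteMeasure m] (P : Kernel E E) [IsMarkovKernel P] (n : ℕ)
    {A : Set E} (hA : MeasurableSet A) : Integrable (fun x => ((P ^ n) x).real A) m := by
  have := isMarkovKernel_pow P n
  refine Integrable.of_bound
    ((P ^ n : Kernel E E).measurable_coe hA).ennreal_toReal.aestronglyMeasurable 1
    (ae_of_all _ fun x => ?_)
  rw [Real.norm_of_nonneg measureReal_nonneg]
  exact measureReal_le_one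

theorem powMassKer_eq (P : Kernel E E) [IsMarkovKernel P] :
    powMassKer P m = dualMass m fun ν => ν.bind P :=
  funext₂ fun n A => integral_real_eq P n A.2

theorem cesaroMassKer_eq [IsFiniteMeasure m] (P : Kernel E E) [IsMarkovKernel P] :
    cesaroMassKer P m = dualCesaroMass m fun ν => ν.bind P := by
  ext n A
  rw [cesaroMassKer, dualCesaroMass, integral_const_mul,
    integral_finsetSum _ fun k _ => integrable_pow_real P k A.2]
  simp only [integral_real_eq P _ A.2]

theorem tfae_kernel [IsFiniteMeasure m] (hm : m ≠ 0) (P : Kernel E E) [IsMarkovKernel P]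
    (hP : m.bind P ≪ m) :
    List.TFAE [
      ∃ ν : Measure E, IsFiniteMeasure ν ∧ ν ≠ 0 ∧ ν ≪ m ∧ P.Invariant ν,
      AlmostInvariantKer P m,
      MeanAlmostInvariantKer P m,
      indexKer P m < m univ] := by
  have h := (isDualMarkov_bind P hP).tfae hm
  rwa [← powMassKer_eq, ← cesaroMassKer_eq] at h

end KernelCase

end AlmostInvariance

/-- A positive linear map between Banach lattices is bounded. -/
theorem LinearMap.continuous_of_nonneg {F G : Type*} [NormedAddCommGroup F] [Lattice F]
    [HasSolidNorm F] [IsOrderedAddMonoid F] [OrderClosedTopology F] [NormedSpace ℝ F]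
    [CompleteSpace F]
    [NormedAddCommGroup G] [Lattice G] [HasSolidNorm G] [IsOrderedAddMonoid G] [NormedSpace ℝ G]
    (P : F →ₗ[ℝ] G) (hP : ∀ f, 0 ≤ f → 0 ≤ P f) : Continuous P := by
  have hmono {f g : F} (hfg : f ≤ g) : P f ≤ P g := by
    simpa using hP (g - f) (sub_nonneg.2 hfg)
  have habs (f : F) : ‖P f‖ ≤ ‖P |f|‖ := by
    refine norm_le_norm_of_abs_le_abs ?_
    rw [abs_of_nonneg (hP _ (abs_nonneg f))]
    refine abs_le'.2 ⟨hmono (le_abs_self f), ?_⟩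
    rw [← map_neg]
    exact hmono (neg_le_abs f)
  by_contra hcon
  -- Unboundedness yields summably small `f n` with `‖P (f n)‖ > n`. The single element `∑ |f n|`
  -- dominates every `|f n|`, so the norm of its image would exceed every `n`.
  have hunb : ∀ n : ℕ, ∃ f : F, ‖f‖ ≤ (1 / 2) ^ n ∧ (n : ℝ) < ‖P f‖ := by
    by_contra! hb
    obtain ⟨n, hn⟩ := hb
    apply hcon
    refine AddMonoidHomClass.continuous_of_bound P (n * 2 ^ n) fun f => ?_
    rcases eq_or_ne f 0 with rfl | hf
    · simp
    have hf' : 0 < ‖f‖ := norm_pos_iff.2 hf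
    have := hn (((1 / 2) ^ n / ‖f‖) • f) (by
      rw [norm_smul, Real.norm_of_nonneg (by positivity), div_mul_cancel₀ _ hf'.ne'])
    rw [map_smul, norm_smul, Real.norm_of_nonneg (by positivity), div_mul_eq_mul_div,
      div_le_iff₀ hf', one_div, inv_pow, inv_mul_le_iff₀ (by positivity)] at this
    linarith
  choose f hf hPf using hunb
  have hsum : Summable fun n => |f n| :=
    Summable.of_norm_bounded (summable_geometric_of_lt_one (by norm_num) (by norm_num))
      fun n => (norm_abs_eq_norm (f n)).trans_le (hf n)
  have hle (n : ℕ) : (n : ℝ) < ‖P (∑' n, |f n|)‖ := by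
    refine (hPf n).trans_le ((habs _).trans (norm_le_norm_of_abs_le_abs ?_))
    rw [abs_of_nonneg (hP _ (abs_nonneg _)), abs_of_nonneg
      (hP _ (tsum_nonneg fun _ => abs_nonneg _))]
    exact hmono (hsum.le_tsum n fun _ _ => abs_nonneg _)
  obtain ⟨n, hn⟩ := exists_nat_gt ‖P (∑' n, |f n|)‖
  exact (hn.trans (hle n)).false

namespace AlmostInvariance

/-! ### Markovian operators on `L^p`: boundedness and countable additivity. -/

section LpCase

variable {E : Type*} [MeasurableSpace E] {m : Measure E} [IsFiniteMeasure m] {p : ℝ≥0∞}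

namespace IsMarkovian

variable {P : Lp ℝ p m →ₗ[ℝ] Lp ℝ p m}

theorem continuous (hP : IsMarkovian P) [Fact (1 ≤ p)] : Continuous P :=
  P.continuous_of_nonneg hP.nonneg

theorem mono (hP : IsMarkovian P) {f g : Lp ℝ p m} (h : f ≤ g) : P f ≤ P g := by
  simpa using hP.nonneg (g - f) (sub_nonneg.2 h)

theorem map_const (hP : IsMarkovian P) (c : ℝ) : P (Lp.const p m c) = Lp.const p m c := by
  have : Lp.const p m c = c • Lp.const p m (1 : ℝ) := by
    have := (Lp.constₗ p m ℝ (E := ℝ)).map_smul c 1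
    simpa using this
  rw [this, map_smul, hP.map_one]

theorem le_const (hP : IsMarkovian P) {f : Lp ℝ p m} {C : ℝ} (h : ∀ᵐ x ∂m, f x ≤ C) :
    ∀ᵐ x ∂m, P f x ≤ C := by
  have h1 : f ≤ Lp.const p m C := by
    rw [← Lp.coeFn_le]
    filter_upwards [h, Lp.coeFn_const p m C] with x h1 h2
    rw [h2]; exact h1
  have h2 := hP.mono h1
  rw [hP.map_const, ← Lp.coeFn_le] at h2
  filter_upwards [h2, Lp.coeFn_const p m C] with x h1 h2
  rw [h2] at h1; exact h1

theorem bounded (hP : IsMarkovian P) {f : Lp ℝ p m} {C : ℝ} (h : ∀ᵐ x ∂m, |f x| ≤ C) :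
    ∀ᵐ x ∂m, |P f x| ≤ C := by
  have h1 := hP.le_const (h.mono fun x hx => (abs_le.1 hx).2)
  have h2 : ∀ᵐ x ∂m, P (-f) x ≤ C := by
    refine hP.le_const ?_
    filter_upwards [h, Lp.coeFn_neg f] with x hx h'
    rw [h', Pi.neg_apply]; linarith [(abs_le.1 hx).1]
  rw [map_neg] at h2
  filter_upwards [h1, h2, Lp.coeFn_neg (P f)] with x h1 h2 h3
  rw [h3, Pi.neg_apply] at h2
  exact abs_le.2 ⟨by linarith, h1⟩

end IsMarkovian

theorem indLp_nonneg (A : SigmaAlg E) : 0 ≤ indLp m p A := by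
  rw [← Lp.coeFn_nonneg]
  filter_upwards [indicatorConstLp_coeFn (p := p) (hs := A.2) (hμs := measure_ne_top m A)
    (c := (1 : ℝ))] with x hx
  rw [indLp, hx]
  exact indicator_nonneg (fun _ _ => zero_le_one) x

theorem indLp_univ : indLp m p ⟨univ, MeasurableSet.univ⟩ = Lp.const p m (1 : ℝ) :=
  indicatorConstLp_univ p m 1

theorem indLp_eq_zero {A : SigmaAlg E} (hA : m A = 0) : indLp m p A = 0 := by
  rw [Lp.eq_zero_iff_ae_eq_zero]
  filter_upwards [indicatorConstLp_coeFn (p := p) (hs := A.2) (hμs := measure_ne_top m A)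
    (c := (1 : ℝ)), measure_eq_zero_iff_ae_notMem.1 hA] with x hx hxA
  rw [indLp, hx]
  exact indicator_of_notMem hxA _

/-- The image of `1_A` under `P`, as an `ℝ≥0∞`-valued function. -/
noncomputable def imageInd (P : Lp ℝ p m →ₗ[ℝ] Lp ℝ p m) (A : Set E) (x : E) : ℝ≥0∞ :=
  open scoped Classical in
  if hA : MeasurableSet A then ENNReal.ofReal (P (indLp m p ⟨A, hA⟩) x) else 0

theorem imageInd_of_measurableSet (P : Lp ℝ p m →ₗ[ℝ] Lp ℝ p m) {A : Set E}
    (hA : MeasurableSet A) :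
    imageInd P A = fun x => ENNReal.ofReal (P (indLp m p ⟨A, hA⟩) x) := by
  ext x
  rw [imageInd, dif_pos hA]

theorem measurable_imageInd (P : Lp ℝ p m →ₗ[ℝ] Lp ℝ p m) {A : Set E} (hA : MeasurableSet A) :
    Measurable (imageInd P A) := by
  rw [imageInd_of_measurableSet P hA]
  exact (Lp.stronglyMeasurable _).measurable.ennreal_ofReal

theorem imageInd_null (P : Lp ℝ p m →ₗ[ℝ] Lp ℝ p m) {A : Set E} (hA : MeasurableSet A)
    (h0 : m A = 0) : imageInd P A =ᵐ[m] 0 := by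
  rw [imageInd_of_measurableSet P hA, indLp_eq_zero (A := ⟨A, hA⟩) h0, map_zero]
  filter_upwards [Lp.coeFn_zero ℝ p m] with x hx
  rw [hx]
  simp

theorem tendsto_sum_indLp [Fact (1 ≤ p)] (hp : p ≠ ∞) {A : ℕ → Set E}
    (hA : ∀ i, MeasurableSet (A i)) (hd : Pairwise (Function.onFun Disjoint A)) :
    Tendsto (fun n => ∑ i ∈ Finset.range n, indLp m p ⟨A i, hA i⟩) atTop
      (𝓝 (indLp m p ⟨⋃ i, A i, MeasurableSet.iUnion hA⟩)) := by
  have hmeas (n : ℕ) : MeasurableSet (⋃ i ∈ Finset.range n, A i) :=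
    Finset.measurableSet_biUnion _ fun i _ => hA i
  have hfin (n : ℕ) : ∑ i ∈ Finset.range n, indLp m p ⟨A i, hA i⟩ =
      indLp m p ⟨⋃ i ∈ Finset.range n, A i, hmeas n⟩ := by
    induction n with
    | zero => simp [indLp_eq_zero]
    | succ n ih =>
      rw [Finset.sum_range_succ, ih]
      have hdis : Disjoint (⋃ i ∈ Finset.range n, A i) (A n) := by
        rw [disjoint_iUnion₂_left]
        exact fun i hi => hd (Finset.mem_range.1 hi).ne
      have := indicatorConstLp_disjoint_union (p := p) (hmeas n) (hA n) (measure_ne_top m _)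
        (measure_ne_top m _) hdis (1 : ℝ)
      refine this.symm.trans ?_
      simp only [indLp]
      congr 1
      rw [Finset.range_add_one, Finset.set_biUnion_insert, union_comm]
  simp only [hfin]
  refine tendsto_indicatorConstLp_set hp ?_
  have hsub (n : ℕ) : ⋃ i ∈ Finset.range n, A i ⊆ ⋃ i, A i :=
    iUnion₂_subset fun i _ => subset_iUnion A i
  have hsd (n : ℕ) : symmDiff (⋃ i ∈ Finset.range n, A i) (⋃ i, A i) =
      (⋃ i, A i) \ ⋃ i ∈ Finset.range n, A i := by
    rw [Set.symmDiff_def, sdiff_eq_empty.2 (hsub n), empty_union]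
  simp only [hsd]
  have h0 : ⋂ n, ((⋃ i, A i) \ ⋃ i ∈ Finset.range n, A i) = ∅ := by
    refine eq_empty_of_forall_notMem fun x hx => ?_
    obtain ⟨i, hi⟩ := mem_iUnion.1 (mem_iInter.1 hx 0).1
    exact (mem_iInter.1 hx (i + 1)).2 (mem_biUnion (by simp) hi)
  rw [← measure_empty (μ := m), ← h0]
  refine tendsto_measure_iInter_atTop
    (fun n => ((MeasurableSet.iUnion hA).diff (hmeas n)).nullMeasurableSet)
    (fun a b hab => ?_) ⟨0, measure_ne_top _ _⟩
  exact sdiff_subset_sdiff_right (biUnion_mono (fun i hi => Finset.range_mono hab hi)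
    fun _ _ => Subset.rfl)

/-- Continuity of `P` gives convergence of the partial sums in `L^p`, hence almost everywhere along
a subsequence. Since the terms are nonnegative, the subsequence determines the whole series. -/
theorem IsMarkovian.imageInd_iUnion [Fact (1 ≤ p)] (hp : p ≠ ∞) {P : Lp ℝ p m →ₗ[ℝ] Lp ℝ p m}
    (hP : IsMarkovian P) {A : ℕ → Set E} (hA : ∀ i, MeasurableSet (A i))
    (hd : Pairwise (Function.onFun Disjoint A)) :
    imageInd P (⋃ i, A i) =ᵐ[m] fun x => ∑' i, imageInd P (A i) x := by
  have hlim := (hP.continuous.tendsto _).comp (tendsto_sum_indLp (m := m) hp hA hd)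
  obtain ⟨ns, hns, hae⟩ := (tendstoInMeasure_of_tendsto_Lp hlim).exists_seq_tendsto_ae
  have hsum (n : ℕ) : ⇑(P (∑ i ∈ Finset.range n, indLp m p ⟨A i, hA i⟩)) =ᵐ[m]
      fun x => ∑ i ∈ Finset.range n, P (indLp m p ⟨A i, hA i⟩) x := by
    rw [map_sum]
    filter_upwards [Lp.coeFn_finsetSum (Finset.range n)
      fun i => P (indLp m p ⟨A i, hA i⟩)] with x hx
    rw [hx, Finset.sum_apply]
  have hnn : ∀ᵐ x ∂m, ∀ i, 0 ≤ P (indLp m p ⟨A i, hA i⟩) x :=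
    ae_all_iff.2 fun i => (Lp.coeFn_nonneg _).2 (hP.nonneg _ (indLp_nonneg _))
  filter_upwards [hae, ae_all_iff.2 hsum, hnn] with x hx hsx hnx
  simp only [imageInd_of_measurableSet P (hA _),
    imageInd_of_measurableSet P (MeasurableSet.iUnion hA)]
  refine tendsto_nhds_unique ((ENNReal.continuous_ofReal.tendsto _).comp hx) ?_
  refine ((ENNReal.tendsto_nat_tsum _).comp hns.tendsto_atTop).congr fun n => ?_
  simp only [Function.comp_apply, hsx]
  exact (ENNReal.ofReal_sum_of_nonneg fun i _ => hnx i).symm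

end LpCase

/-! ### Duality between `P` and its action on measures. -/

section LpDuality

variable {E : Type*} [MeasurableSpace E] {m : Measure E} {p : ℝ≥0∞}
  {P : Lp ℝ p m →ₗ[ℝ] Lp ℝ p m} {T : Measure E → Measure E}

theorem integrable_of_ae_bound {ν : Measure E} [IsFiniteMeasure ν] (hν : ν ≪ m)
    {f : Lp ℝ p m} {C : ℝ} (h : ∀ᵐ x ∂m, |f x| ≤ C) : Integrable f ν :=
  Integrable.of_bound (Lp.stronglyMeasurable f).aestronglyMeasurable C (hν.ae_le h)

variable [IsFiniteMeasure m]

theorem IsMarkovian.imageInd_univ (hP : IsMarkovian P) : imageInd P univ =ᵐ[m] 1 := by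
  rw [imageInd_of_measurableSet P MeasurableSet.univ, indLp_univ, hP.map_one]
  filter_upwards [Lp.coeFn_const p m (1 : ℝ)] with x hx
  simp only [hx]
  simp

theorem IsMarkovian.exists_isDualMarkov [Fact (1 ≤ p)] (hp : p ≠ ∞) (hP : IsMarkovian P) :
    ∃ T, IsDualMarkov m (imageInd P) T := by
  have hex (ν : Measure E) : ∃ μ : Measure E, ν ≪ m → ∀ A, MeasurableSet A →
      μ A = ∫⁻ x, imageInd P A x ∂ν := by
    by_cases hν : ν ≪ m
    · refine ⟨Measure.ofMeasurable (fun A _ => ∫⁻ x, imageInd P A x ∂ν) ?_ ?_,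
        fun _ A hA => Measure.ofMeasurable_apply A hA⟩
      · rw [lintegral_congr_ae (hν.ae_le (imageInd_null P MeasurableSet.empty measure_empty))]
        simp
      · intro A hA hd
        rw [lintegral_congr_ae (hν.ae_le (hP.imageInd_iUnion hp hA hd)),
          lintegral_tsum fun i => (measurable_imageInd P (hA i)).aemeasurable]
    -- A default value; `T` matters only on measures `≪ m`.
    · exact ⟨0, fun h => absurd h hν⟩
  choose T hT using hex
  refine ⟨T, hT, fun A hA => measurable_imageInd P hA, fun ν hν => ?_, fun ν hν => ?_⟩
  · rw [hT ν hν univ MeasurableSet.univ, lintegral_congr_ae (hν.ae_le hP.imageInd_univ)]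
    simp
  · refine Measure.AbsolutelyContinuous.mk fun A hA h0 => ?_
    rw [hT ν hν A hA, lintegral_congr_ae (hν.ae_le (imageInd_null P hA h0))]
    simp

theorem ae_abs_indLp_le (A : SigmaAlg E) : ∀ᵐ x ∂m, |indLp m p A x| ≤ 1 := by
  filter_upwards [indicatorConstLp_coeFn (p := p) (hs := A.2) (hμs := measure_ne_top m A)
    (c := (1 : ℝ))] with x hx
  rw [indLp, hx]
  by_cases hxA : x ∈ A.1 <;> simp [hxA]

theorem integral_indLp {ν : Measure E} (hν : ν ≪ m) (A : SigmaAlg E) :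
    ∫ x, indLp m p A x ∂ν = ν.real A := by
  rw [indLp, integral_congr_ae (hν.ae_le indicatorConstLp_coeFn), integral_indicator_const _ A.2]
  simp

/-- Bounded functions are uniform limits of simple functions. -/
theorem exists_sum_indLp_near {f : Lp ℝ p m} {C : ℝ} (h : ∀ᵐ x ∂m, |f x| ≤ C) {ε : ℝ}
    (hε : 0 < ε) : ∃ (s : Finset ℤ) (c : ℤ → ℝ) (B : ℤ → SigmaAlg E),
      ∀ᵐ x ∂m, |(f - ∑ k ∈ s, c k • indLp m p (B k)) x| ≤ ε := by
  have hmeas (k : ℤ) : MeasurableSet {x | ⌊f x / ε⌋ = k} :=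
    ((Lp.stronglyMeasurable f).measurable.div_const ε).floor (measurableSet_singleton k)
  -- Rounding `f` down to a multiple of `ε`; the bound `C` leaves finitely many levels.
  refine ⟨Finset.Icc ⌊-C / ε⌋ ⌊C / ε⌋, fun k => ε * k, fun k => ⟨_, hmeas k⟩, ?_⟩
  have hind : ∀ᵐ x ∂m, ∀ k : ℤ, (((ε * k : ℝ) • indLp m p ⟨_, hmeas k⟩ : Lp ℝ p m) : E → ℝ) x =
      if ⌊f x / ε⌋ = k then ε * k else 0 := by
    refine ae_all_iff.2 fun k => ?_
    filter_upwards [indicatorConstLp_coeFn (p := p) (hs := hmeas k)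
      (hμs := measure_ne_top m _) (c := (1 : ℝ)),
      Lp.coeFn_smul (ε * k : ℝ) (indLp m p ⟨_, hmeas k⟩)] with x h1 h2
    rw [h2, Pi.smul_apply, indLp, h1, indicator_apply]
    simp
  filter_upwards [h, hind, Lp.coeFn_sub f (∑ k ∈ Finset.Icc ⌊-C / ε⌋ ⌊C / ε⌋,
    (ε * k : ℝ) • indLp m p ⟨_, hmeas k⟩), Lp.coeFn_finsetSum (Finset.Icc ⌊-C / ε⌋ ⌊C / ε⌋)
      fun k : ℤ => (ε * k : ℝ) • indLp m p ⟨_, hmeas k⟩] with x hx h1 h2 h3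
  rw [h2, Pi.sub_apply, h3, Finset.sum_apply]
  simp only [h1]
  rw [Finset.sum_ite_eq, if_pos]
  · have h4 := Int.floor_le (f x / ε)
    have h5 := Int.lt_floor_add_one (f x / ε)
    rw [le_div_iff₀ hε] at h4
    rw [div_lt_iff₀ hε] at h5
    rw [abs_le]
    constructor <;> linarith
  · rw [Finset.mem_Icc]
    obtain ⟨h4, h5⟩ := abs_le.1 hx
    exact ⟨Int.floor_mono (by gcongr), Int.floor_mono (by gcongr)⟩

/-- Duality between `P` and `T` on bounded functions. -/
theorem IsMarkovian.integral_eq (hP : IsMarkovian P) (hT : IsDualMarkov m (imageInd P) T)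
    {ν : Measure E} [IsFiniteMeasure ν] (hν : ν ≪ m) {f : Lp ℝ p m} {C : ℝ}
    (h : ∀ᵐ x ∂m, |f x| ≤ C) : ∫ x, P f x ∂ν = ∫ x, f x ∂T ν := by
  have hTν := hT.ac ν hν
  have : IsFiniteMeasure (T ν) := ⟨by rw [hT.map_univ ν hν]; exact measure_lt_top ν univ⟩
  have hind (A : SigmaAlg E) : ∫ x, P (indLp m p A) x ∂ν = ∫ x, indLp m p A x ∂T ν := by
    rw [integral_indLp hTν, integral_eq_lintegral_of_nonneg_ae
      (hν.ae_le ((Lp.coeFn_nonneg _).2 (hP.nonneg _ (indLp_nonneg A))))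
      (Lp.stronglyMeasurable _).aestronglyMeasurable, Measure.real, hT.apply ν hν A A.2,
      imageInd_of_measurableSet P A.2]
  have hadd {f g : Lp ℝ p m} (hf : ∃ C, ∀ᵐ x ∂m, |f x| ≤ C) (hg : ∃ C, ∀ᵐ x ∂m, |g x| ≤ C)
      {μ : Measure E} [IsFiniteMeasure μ] (hμ : μ ≪ m) :
      ∫ x, (f + g) x ∂μ = ∫ x, f x ∂μ + ∫ x, g x ∂μ := by
    obtain ⟨C₁, h₁⟩ := hf
    obtain ⟨C₂, h₂⟩ := hg
    rw [integral_congr_ae (hμ.ae_le (Lp.coeFn_add f g))]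
    exact integral_add (integrable_of_ae_bound hμ h₁) (integrable_of_ae_bound hμ h₂)
  have hPb {f : Lp ℝ p m} (hf : ∃ C, ∀ᵐ x ∂m, |f x| ≤ C) : ∃ C, ∀ᵐ x ∂m, |P f x| ≤ C :=
    hf.imp fun _ => hP.bounded
  have hsimple (s : Finset ℤ) (c : ℤ → ℝ) (B : ℤ → SigmaAlg E) :
      (∃ C, ∀ᵐ x ∂m, |(∑ k ∈ s, c k • indLp m p (B k)) x| ≤ C) ∧
      ∫ x, P (∑ k ∈ s, c k • indLp m p (B k)) x ∂ν =
        ∫ x, (∑ k ∈ s, c k • indLp m p (B k)) x ∂T ν := by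
    refine Finset.sum_induction _ (fun f : Lp ℝ p m => (∃ C, ∀ᵐ x ∂m, |f x| ≤ C) ∧
      ∫ x, P f x ∂ν = ∫ x, f x ∂T ν) ?_ ?_ ?_
    · rintro f g ⟨hf, hf'⟩ ⟨hg, hg'⟩
      refine ⟨?_, ?_⟩
      · obtain ⟨C₁, h₁⟩ := hf
        obtain ⟨C₂, h₂⟩ := hg
        refine ⟨C₁ + C₂, ?_⟩
        filter_upwards [h₁, h₂, Lp.coeFn_add f g] with x h₁ h₂ h₃
        rw [h₃]
        exact (abs_add_le _ _).trans (add_le_add h₁ h₂)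
      · rw [map_add, hadd (hPb hf) (hPb hg) hν, hadd hf hg hTν, hf', hg']
    · refine ⟨⟨0, ?_⟩, ?_⟩
      · filter_upwards [Lp.coeFn_zero ℝ p m] with x hx
        rw [hx]
        simp
      · rw [map_zero, integral_congr_ae (hν.ae_le (Lp.coeFn_zero ℝ p m)),
          integral_congr_ae (hTν.ae_le (Lp.coeFn_zero ℝ p m))]
        simp
    · intro k _
      refine ⟨⟨|c k|, ?_⟩, ?_⟩
      · filter_upwards [ae_abs_indLp_le (p := p) (B k),
          Lp.coeFn_smul (c k) (indLp m p (B k))] with x h1 h2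
        rw [h2, Pi.smul_apply, smul_eq_mul, abs_mul]
        exact mul_le_of_le_one_right (abs_nonneg _) h1
      · rw [map_smul, integral_congr_ae (hν.ae_le (Lp.coeFn_smul (c k) (P (indLp m p (B k))))),
          integral_congr_ae (hTν.ae_le (Lp.coeFn_smul (c k) (indLp m p (B k))))]
        simp only [Pi.smul_apply, integral_smul, hind]
  -- The density of `ν` need not lie in the dual of `L^p`, so continuity of `P` in `L^p` does not
  -- help here. Instead `P` preserves almost-everywhere bounds, so a uniform error `ε` stays `ε`.
  have hclose : ∀ ε : ℝ, 0 < ε →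
      |∫ x, P f x ∂ν - ∫ x, f x ∂T ν| ≤ ε * (ν.real univ + (T ν).real univ) := by
    intro ε hε
    obtain ⟨s, c, B, hB⟩ := exists_sum_indLp_near h hε
    obtain ⟨hgb, hg⟩ := hsimple s c B
    set g := ∑ k ∈ s, c k • indLp m p (B k)
    have hfg : f = g + (f - g) := by abel
    have h1 : ∫ x, P f x ∂ν = ∫ x, P g x ∂ν + ∫ x, P (f - g) x ∂ν := by
      conv_lhs => rw [hfg, map_add]
      exact hadd (hPb hgb) (hPb ⟨ε, hB⟩) hν
    have h2 : ∫ x, f x ∂T ν = ∫ x, g x ∂T ν + ∫ x, (f - g) x ∂T ν := by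
      conv_lhs => rw [hfg]
      exact hadd hgb ⟨ε, hB⟩ hTν
    have h3 : |∫ x, P (f - g) x ∂ν| ≤ ε * ν.real univ :=
      norm_integral_le_of_norm_le_const (f := P (f - g)) (hν.ae_le (hP.bounded hB))
    have h4 : |∫ x, (f - g) x ∂T ν| ≤ ε * (T ν).real univ :=
      norm_integral_le_of_norm_le_const (f := ⇑(f - g)) (hTν.ae_le hB)
    rw [h1, h2, hg, add_sub_add_left_eq_sub, mul_add]
    exact (abs_sub _ _).trans (add_le_add h3 h4)
  have hlim : Tendsto (fun ε : ℝ => ε * (ν.real univ + (T ν).real univ)) (𝓝[>] 0) (𝓝 0) := by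
    refine Tendsto.mono_left ?_ nhdsWithin_le_nhds
    have := (continuous_id.mul_const (ν.real univ + (T ν).real univ)).tendsto 0
    simpa using this
  have h0 := ge_of_tendsto hlim (by
    filter_upwards [self_mem_nhdsWithin] with ε hε using hclose ε hε)
  exact sub_eq_zero.1 (abs_eq_zero.1 (le_antisymm h0 (abs_nonneg _)))

/-- The outermost `T` is moved onto `f`; the induction then continues with `P f`, which obeys the
same bound `C`. -/
theorem IsMarkovian.integral_pow_eq (hP : IsMarkovian P) (hT : IsDualMarkov m (imageInd P) T)
    (n : ℕ) {f : Lp ℝ p m} {C : ℝ} (h : ∀ᵐ x ∂m, |f x| ≤ C) :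
    Integrable ((P ^ n) f) m ∧ ∫ x, (P ^ n) f x ∂m = ∫ x, f x ∂T^[n] m := by
  induction n generalizing f with
  | zero => exact ⟨integrable_of_ae_bound Measure.AbsolutelyContinuous.rfl h, rfl⟩
  | succ n ih =>
    have := hT.isFiniteMeasure_iterate n
    have hac := hT.iterate_ac Measure.AbsolutelyContinuous.rfl n
    rw [pow_succ, Module.End.mul_apply, Function.iterate_succ_apply',
      ← hP.integral_eq hT hac h]
    exact ih (hP.bounded h)

theorem IsMarkovian.powMassLp_eq (hP : IsMarkovian P) (hT : IsDualMarkov m (imageInd P) T) :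
    powMassLp P = dualMass m T := by
  ext n A
  rw [powMassLp, (hP.integral_pow_eq hT n (ae_abs_indLp_le A)).2,
    integral_indLp (hT.iterate_ac Measure.AbsolutelyContinuous.rfl n)]
  rfl

theorem IsMarkovian.cesaroMassLp_eq (hP : IsMarkovian P) (hT : IsDualMarkov m (imageInd P) T) :
    cesaroMassLp P = dualCesaroMass m T := by
  ext n A
  have hae : ⇑(cesaroLp P n (indLp m p A)) =ᵐ[m]
      fun x => (1 / (n : ℝ)) * ∑ k ∈ Finset.range n, (P ^ k) (indLp m p A) x := by
    rw [cesaroLp, LinearMap.smul_apply, LinearMap.sum_apply]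
    filter_upwards [Lp.coeFn_smul (1 / (n : ℝ)) (∑ k ∈ Finset.range n, (P ^ k) (indLp m p A)),
      Lp.coeFn_finsetSum (Finset.range n) fun k => (P ^ k) (indLp m p A)] with x h1 h2
    rw [h1, Pi.smul_apply, h2, Finset.sum_apply, smul_eq_mul]
  have hb := ae_abs_indLp_le (m := m) (p := p) A
  rw [cesaroMassLp, dualCesaroMass, integral_congr_ae hae, integral_const_mul,
    integral_finsetSum _ fun k _ => (hP.integral_pow_eq hT k hb).1]
  congr 1
  refine Finset.sum_congr rfl fun k _ => ?_
  rw [(hP.integral_pow_eq hT k hb).2,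
    integral_indLp (hT.iterate_ac Measure.AbsolutelyContinuous.rfl k)]

/-- Duality turns the integral of `P f` against `ν` into that of `f` against `T ν`; indicators
suffice to recover `T ν = ν`. -/
theorem IsMarkovian.isACInvariantLp_iff (hP : IsMarkovian P)
    (hT : IsDualMarkov m (imageInd P) T) {ν : Measure E} [IsFiniteMeasure ν] :
    IsACInvariantLp P ν ↔ ν ≪ m ∧ T ν = ν := by
  refine and_congr_right fun hν => ⟨fun H => ?_, fun H f hf C hC => ?_⟩
  · have : IsFiniteMeasure (T ν) := ⟨by rw [hT.map_univ ν hν]; exact measure_lt_top ν univ⟩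
    ext A hA
    have h1 : ∫ x, P (indLp m p ⟨A, hA⟩) x ∂ν = ∫ x, A.indicator (fun _ => (1 : ℝ)) x ∂ν :=
      H (A.indicator fun _ => (1 : ℝ)) (measurable_const.indicator hA) 1 fun x => by
        by_cases hx : x ∈ A <;> simp [hx]
    rw [hP.integral_eq hT hν (ae_abs_indLp_le ⟨A, hA⟩), integral_indLp (hT.ac ν hν),
      integral_indicator_const _ hA, smul_eq_mul, mul_one] at h1
    exact (measureReal_eq_measureReal_iff).1 h1
  · have hmem := MemLp.of_bound (p := p) hf.aestronglyMeasurable C (ae_of_all m hC)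
    have hb : ∀ᵐ x ∂m, |hmem.toLp f x| ≤ C := by
      filter_upwards [hmem.coeFn_toLp] with x hx
      rw [hx]
      exact hC x
    rw [hP.integral_eq hT hν hb, H]
    exact integral_congr_ae (hν.ae_le hmem.coeFn_toLp)

theorem tfae_lp [Fact (1 ≤ p)] (hm : m ≠ 0) (hp : p ≠ ∞) (hP : IsMarkovian P) :
    List.TFAE [
      ∃ ν : Measure E, IsFiniteMeasure ν ∧ ν ≠ 0 ∧ IsACInvariantLp P ν,
      AlmostInvariantLp P,
      MeanAlmostInvariantLp P,
      indexLp P < m univ] := by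
  obtain ⟨T, hT⟩ := hP.exists_isDualMarkov hp
  have h := hT.tfae hm
  rw [← hP.powMassLp_eq hT, ← hP.cesaroMassLp_eq hT] at h
  have hiff : (∃ ν : Measure E, IsFiniteMeasure ν ∧ ν ≠ 0 ∧ IsACInvariantLp P ν) ↔
      ∃ ν : Measure E, IsFiniteMeasure ν ∧ ν ≠ 0 ∧ ν ≪ m ∧ T ν = ν :=
    exists_congr fun ν => and_congr_right fun _ => and_congr_right fun _ =>
      hP.isACInvariantLp_iff hT
  rwa [hiff]

end LpDuality

end AlmostInvariance

theorem theorem2p3p1 {E : Type*} [MeasurableSpace E] (m : Measure E) [IsFiniteMeasure m]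
    (hm : m ≠ 0) :
    (∀ p : ℝ≥0∞, 1 ≤ p → p ≠ ∞ → ∀ P : Lp ℝ p m →ₗ[ℝ] Lp ℝ p m,
      AlmostInvariance.IsMarkovian P →
      List.TFAE [
        ∃ ν : Measure E, IsFiniteMeasure ν ∧ ν ≠ 0 ∧ AlmostInvariance.IsACInvariantLp P ν,
        AlmostInvariance.AlmostInvariantLp P,
        AlmostInvariance.MeanAlmostInvariantLp P,
        AlmostInvariance.indexLp P < m univ]) ∧
    (∀ P : Kernel E E, IsMarkovKernel P → m.bind P ≪ m →
      List.TFAE [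
        ∃ ν : Measure E, IsFiniteMeasure ν ∧ ν ≠ 0 ∧ ν ≪ m ∧ P.Invariant ν,
        AlmostInvariance.AlmostInvariantKer P m,
        AlmostInvariance.MeanAlmostInvariantKer P m,
        AlmostInvariance.indexKer P m < m univ]) :=
  ⟨fun _ hp1 hp _ hP => have := Fact.mk hp1; AlmostInvariance.tfae_lp hm hp hP,
    fun P _ hP => AlmostInvariance.tfae_kernel hm P hP⟩
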